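/- Let $d\in\mathbb N$, use the quadratic cost $c(x,y)=\tfrac12|x-y|^2$ on $\mathbb R^d$, and let $\mu,\nu$ be Borel probability measures on $\mathbb R^d$ such that $\operatorname{supp}\nu$ is compact. An optimal Monge map from a probability measure $\rho$ to $\nu$ is a Borel map $T:\mathbb R^d\to\mathbb R^d$ with $T_\#\rho=\nu$ that minimizes $\int c(x,T(x))\,d\rho(x)\in[0,\infty]$ among all Borel maps pushing $\rho$ forward to $\nu$. Suppose that there is no optimal Monge map from $\mu$ to $\nu$. For every $\varepsilon>0$ let $\mu_\varepsilon$ be a Borel probability measure on $\mathbb R^d$ with finite second moment and $\mu_\varepsilon\ll\mathcal L^d$, and let $T_\varepsilon:\mathbb R^d\to\mathbb R^d$ be an optimal Monge map from $\mu_\varepsilon$ to $\nu$. If $\mu_\varepsilon\rightharpoonup\mu$ weakly (against bounded continuous functions) as $\varepsilon\downarrow0$, then there exists $R_0>0$ such that $$\sup_{0<\varepsilon\le 1}\ \|\nabla T_\varepsilon\|_{L^\infty(B_{R_0})}=+\infty .$$ Here $B_{R_0}$ is the open ball of radius $R_0$ centred at $0$, $\nabla T_\varepsilon$ is the distributional gradient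 on $B_{R_0}$, the $L^\infty$ norm is taken with respect to Lebesgue measure (with the operator norm of matrices), and $\|\nabla T_\varepsilon\|_{L^\infty(B_{R_0})}=+\infty$ if $T_\varepsilon$ is not locally integrable on $B_{R_0}$ or its distributional gradient there is not a locally integrable function. -/

import Mathlib

open MeasureTheory Filter Topology Set
open scoped ENNReal ContDiff

/-- The Monge cost `∫ c(x, T x) dμ(x)` of a map `T` for the quadratic cost
`c(x, y) = |x - y|² / 2`, as an extended nonnegative number. -/
noncomputable def quadraticMongeCost {d : ℕ}
    (μ : Measure (EuclideanSpace ℝ (Fin d)))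
    (T : EuclideanSpace ℝ (Fin d) → EuclideanSpace ℝ (Fin d)) : ℝ≥0∞ :=
  ∫⁻ x, ENNReal.ofReal ((1 / 2 : ℝ) * ‖x - T x‖ ^ 2) ∂μ

/-- `T` is an optimal Monge map from `μ` to `ν` for the quadratic cost: it is a Borel map with
`T_# μ = ν`, and it minimizes the Monge cost among all Borel maps pushing `μ` forward to `ν`. -/
def IsOptimalMongeMap {d : ℕ} (μ ν : Measure (EuclideanSpace ℝ (Fin d)))
    (T : EuclideanSpace ℝ (Fin d) → EuclideanSpace ℝ (Fin d)) : Prop :=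
  Measurable T ∧ μ.map T = ν ∧
    ∀ S : EuclideanSpace ℝ (Fin d) → EuclideanSpace ℝ (Fin d),
      Measurable S → μ.map S = ν → quadraticMongeCost μ T ≤ quadraticMongeCost μ S

/-- `G` is a weak (distributional) gradient of `T` on the open set `Ω`: both are locally integrable
on `Ω` with respect to Lebesgue measure, and `∫_Ω (∂_v φ) T = - ∫_Ω φ (G v)` for every test function
`φ ∈ C_c^∞(Ω)` and every direction `v`. -/
def IsWeakGradientOn {d : ℕ} (Ω : Set (EuclideanSpace ℝ (Fin d)))
    (T : EuclideanSpace ℝ (Fin d) → EuclideanSpace ℝ (Fin d))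
    (G : EuclideanSpace ℝ (Fin d) →
      (EuclideanSpace ℝ (Fin d) →L[ℝ] EuclideanSpace ℝ (Fin d))) : Prop :=
  LocallyIntegrableOn T Ω volume ∧ LocallyIntegrableOn G Ω volume ∧
    ∀ φ : EuclideanSpace ℝ (Fin d) → ℝ,
      ContDiff ℝ ∞ φ → HasCompactSupport φ → tsupport φ ⊆ Ω →
        ∀ v : EuclideanSpace ℝ (Fin d),
          ∫ x in Ω, (fderiv ℝ φ x v) • T x = -∫ x in Ω, φ x • G x v

/-- The norm `‖∇T‖_{L^∞(Ω)}` of the weak gradient of `T` on the open set `Ω`: the essential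
supremum over `Ω` of the operator norm of the weak gradient. The weak gradient is unique up to
Lebesgue-null sets, so the infimum only serves to give the value `∞` when there is none. -/
noncomputable def gradLinftyNorm {d : ℕ} (Ω : Set (EuclideanSpace ℝ (Fin d)))
    (T : EuclideanSpace ℝ (Fin d) → EuclideanSpace ℝ (Fin d)) : ℝ≥0∞ :=
  ⨅ (G : EuclideanSpace ℝ (Fin d) →
      (EuclideanSpace ℝ (Fin d) →L[ℝ] EuclideanSpace ℝ (Fin d)))
    (_ : IsWeakGradientOn Ω T G), eLpNorm G ∞ (volume.restrict Ω)

/-! Argue by contradiction. If the gradients were bounded on every ball uniformly in `ε ≤ 1`,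
mollification would give each `T ε` a continuous representative `F ε`, Lipschitz on each ball with a
constant independent of `ε`. Mass of `με ε` near a point of `supp μ` is sent into the compact `supp
ν`, so the `F ε` are also locally bounded and have a locally Lipschitz limit `f` as `ε ↓ 0`. It
remains to see that `f` is an optimal map from `μ` to `ν`.

Transport: convergence of `F ε` is locally uniform enough to combine with weak convergence, giving
`f_# μ = ν` (`map_eq_of_tendsto`).

Optimality: since `με ε` has no atoms, small pieces of equal mass can be permuted, and comparing `F
ε` with its rearrangements gives an approximate cyclic monotonicity
(`IsOptimalMongeMap.sum_nonneg`). In the limit it becomes cyclic monotonicity of `f` on `supp μ`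
(`cyclicallyMonotone_of_tendsto`). Rockafellar's potential and its conjugate then certify that `f`
is optimal (`isOptimalMongeMap_of_cyclicallyMonotone`). If `μ` has infinite second moment, every
transport to `ν` costs `⊤` and there is nothing to minimize. -/

/-! ### Atomless measures and mass-preserving rearrangements -/

open ProbabilityTheory in
/-- The cumulative distribution function of an atomless probability measure on the line
pushes it forward to the uniform distribution. -/
lemma map_cdf_Iic (q : Measure ℝ) [IsProbabilityMeasure q] [NullSingletonClass q] {t : ℝ}
    (h0 : 0 ≤ t) (h1 : t ≤ 1) : q {x | cdf q x ≤ t} = ENNReal.ofReal t := by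
  have hcont : Continuous (cdf q) := by
    rw [continuous_iff_continuousAt]
    intro x
    rw [(cdf q).mono.continuousAt_iff_leftLim_eq_rightLim, StieltjesFunction.rightLim_eq]
    have h := (cdf q).measure_singleton x
    rw [measure_cdf, measure_singleton] at h
    have h2 := ENNReal.ofReal_eq_zero.1 h.symm
    exact le_antisymm ((cdf q).mono.leftLim_le le_rfl) (by linarith)
  -- For `t = 1` the sublevel set is the whole line, which has no supremum.
  rcases h1.eq_or_lt with rfl | h1
  · simp [cdf_le_one]
  by_cases hne : {x | cdf q x ≤ t}.Nonempty
  · have hcl : IsClosed {x | cdf q x ≤ t} := isClosed_le hcont continuous_const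
    obtain ⟨b, hb⟩ := ((tendsto_cdf_atTop q).eventually (lt_mem_nhds h1)).exists
    have hbd : BddAbove {x | cdf q x ≤ t} :=
      ⟨b, fun x hx => by
        by_contra! hlt
        exact absurd (((cdf q).mono hlt.le).trans hx) (not_le.2 hb)⟩
    set s := sSup {x | cdf q x ≤ t} with hs
    have hmem : cdf q s ≤ t := hcl.csSup_mem hne hbd
    have hge : t ≤ cdf q s := by
      refine ge_of_tendsto (hcont.continuousAt.tendsto.mono_left nhdsWithin_le_nhds :
        Tendsto (cdf q) (𝓝[>] s) _) ?_
      filter_upwards [self_mem_nhdsWithin] with y hy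
      by_contra! hlt
      exact absurd (le_csSup hbd hlt.le) (not_le.2 hy)
    have hset : {x | cdf q x ≤ t} = Iic s := by
      ext x
      exact ⟨fun hx => le_csSup hbd hx, fun hx => ((cdf q).mono hx).trans hmem⟩
    rw [hset, ← ofReal_cdf, le_antisymm hmem hge]
  · rw [not_nonempty_iff_eq_empty] at hne
    rw [hne, measure_empty]
    have : t ≤ 0 := by
      refine ge_of_tendsto (tendsto_cdf_atBot q) (Eventually.of_forall fun x => ?_)
      by_contra! hlt
      exact (hne ▸ (show x ∈ {x | cdf q x ≤ t} from hlt.le) : x ∈ (∅ : Set ℝ))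
    rw [le_antisymm this h0, ENNReal.ofReal_zero]

open ProbabilityTheory in
/-- Every atomless probability measure on a standard Borel space has a uniformly distributed
random variable. -/
lemma exists_measurable_map_eq_unitInterval_volume {X : Type*} [MeasurableSpace X]
    [StandardBorelSpace X] (p : Measure X) [IsProbabilityMeasure p] [NullSingletonClass p] :
    ∃ g : X → unitInterval, Measurable g ∧ p.map g = volume := by
  have he := measurableEmbedding_embeddingReal X
  set e := embeddingReal X
  have : IsProbabilityMeasure (p.map e) := Measure.isProbabilityMeasure_map he.measurable.aemeasurable
  have : NullSingletonClass (p.map e) := ⟨fun x => by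
    rw [he.map_apply]
    exact (subsingleton_singleton.preimage he.injective).measure_zero _⟩
  have hm : Measurable (cdf (p.map e)) := (cdf (p.map e)).mono.measurable
  refine ⟨fun x => ⟨cdf (p.map e) (e x), cdf_nonneg _ _, cdf_le_one _ _⟩,
    (hm.comp he.measurable).subtype_mk, ?_⟩
  have hgm : Measurable fun x => (⟨cdf (p.map e) (e x), cdf_nonneg _ _, cdf_le_one _ _⟩ :
      unitInterval) := (hm.comp he.measurable).subtype_mk
  have := Measure.isProbabilityMeasure_map (μ := p) hgm.aemeasurable
  refine Measure.ext_of_Iic _ _ fun t => ?_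
  rw [Measure.map_apply hgm measurableSet_Iic, unitInterval.volume_Iic,
    ← map_cdf_Iic (p.map e) t.2.1 t.2.2, he.map_apply]
  rfl

/-- An atomless finite measure takes all intermediate values. -/
lemma exists_measurableSet_subset_measure_eq {X : Type*} [MeasurableSpace X]
    [StandardBorelSpace X] (μ : Measure X) [IsFiniteMeasure μ] [NullSingletonClass μ] {B : Set X}
    (hB : MeasurableSet B) {m : ℝ≥0∞} (hm : m ≤ μ B) :
    ∃ A ⊆ B, MeasurableSet A ∧ μ A = m := by
  rcases eq_or_ne (μ B) 0 with h0 | h0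
  · exact ⟨∅, empty_subset _, .empty, by simpa [h0, eq_comm] using hm⟩
  have htop := measure_ne_top μ B
  have hp : IsProbabilityMeasure ((μ B)⁻¹ • μ.restrict B) := ⟨by
    simp [ENNReal.inv_mul_cancel h0 htop]⟩
  have hna : NullSingletonClass ((μ B)⁻¹ • μ.restrict B) := ⟨fun x => by simp⟩
  obtain ⟨g, hg, hmap⟩ :=
    exists_measurable_map_eq_unitInterval_volume ((μ B)⁻¹ • μ.restrict B)
  have hle : m / μ B ≤ 1 := ENNReal.div_le_of_le_mul (by simpa using hm)
  let t : unitInterval := ⟨(m / μ B).toReal, ENNReal.toReal_nonneg,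
    ENNReal.toReal_le_of_le_ofReal zero_le_one (by simpa using hle)⟩
  refine ⟨g ⁻¹' Iic t ∩ B, inter_subset_right, (hg measurableSet_Iic).inter hB, ?_⟩
  have h := congrArg (fun ρ => ρ (Iic t)) hmap
  simp only [Measure.map_apply hg measurableSet_Iic, Measure.smul_apply, smul_eq_mul,
    Measure.restrict_apply (hg measurableSet_Iic), unitInterval.volume_Iic] at h
  rw [show ENNReal.ofReal (t : ℝ) = m / μ B from
    ENNReal.ofReal_toReal (hle.trans_lt ENNReal.one_lt_top).ne] at h
  rw [← one_mul (μ _), ← ENNReal.mul_inv_cancel h0 htop, mul_assoc, h,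
    ENNReal.mul_div_cancel h0 htop]

/-- Disjoint subsets of equal mass of finitely many sets of positive mass. -/
lemma exists_pairwiseDisjoint_subset_measure_eq {X ι : Type*} [MeasurableSpace X]
    [StandardBorelSpace X] (μ : Measure X) [IsFiniteMeasure μ] [NullSingletonClass μ] {B : ι → Set X}
    (hB : ∀ i, MeasurableSet (B i)) (m : ℝ≥0∞) (s : Finset ι)
    (hm : ∀ i ∈ s, s.card * m ≤ μ (B i)) :
    ∃ A : ι → Set X, (∀ i, A i ⊆ B i) ∧ (∀ i, MeasurableSet (A i)) ∧ (∀ i ∈ s, μ (A i) = m) ∧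
      (s : Set ι).PairwiseDisjoint A := by
  classical
  induction s using Finset.induction_on with
  | empty => exact ⟨fun _ => ∅, by simp⟩
  | insert a s ha ih =>
    obtain ⟨A, hAB, hA, hAm, hd⟩ := ih fun i hi => le_trans
      (by gcongr; exact Finset.subset_insert _ _) (hm i (Finset.mem_insert_of_mem hi))
    have hU : MeasurableSet (⋃ i ∈ s, A i) := s.measurableSet_biUnion fun i _ => hA i
    have hUm : μ (⋃ i ∈ s, A i) ≤ s.card * m := by
      refine (measure_biUnion_finset_le s A).trans ?_
      rw [Finset.sum_congr rfl hAm, Finset.sum_const, nsmul_eq_mul]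
    -- Greedy choice: the earlier pieces use at most `s.card * m` of the mass of `B a`, which leaves
    -- at least `m`.
    have hle : m ≤ μ (B a \ ⋃ i ∈ s, A i) := by
      have h1 := hm a (Finset.mem_insert_self _ _)
      rw [Finset.card_insert_of_notMem ha] at h1
      by_cases hfin : (s.card : ℝ≥0∞) * m = ⊤
      · have : (↑(s.card + 1) : ℝ≥0∞) * m = ⊤ := by
          push_cast
          rw [add_mul, hfin, top_add]
        rw [this] at h1
        exact absurd (top_le_iff.1 h1) (measure_ne_top _ _)
      · have h2 : (s.card : ℝ≥0∞) * m + m ≤ s.card * m + μ (B a \ ⋃ i ∈ s, A i) := by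
          calc (s.card : ℝ≥0∞) * m + m = ↑(s.card + 1) * m := by push_cast; ring
            _ ≤ μ (B a) := h1
            _ ≤ μ (⋃ i ∈ s, A i) + μ (B a \ ⋃ i ∈ s, A i) := by
              refine (measure_mono ?_).trans (measure_union_le _ _)
              rw [union_sdiff_self]
              exact subset_union_right
            _ ≤ _ := by gcongr
        exact (ENNReal.add_le_add_iff_left hfin).1 h2
    obtain ⟨C, hCB, hC, hCm⟩ := exists_measurableSet_subset_measure_eq μ ((hB a).diff hU) hle
    refine ⟨Function.update A a C, fun i => ?_, fun i => ?_, fun i hi => ?_, ?_⟩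
    · rcases eq_or_ne i a with rfl | h
      · simpa using hCB.trans sdiff_subset
      · simpa [h] using hAB i
    · rcases eq_or_ne i a with rfl | h
      · simpa using hC
      · simpa [h] using hA i
    · rcases eq_or_ne i a with rfl | h
      · simpa using hCm
      · simpa [h] using hAm i ((Finset.mem_insert.1 hi).resolve_left h)
    · have key : ∀ i ∈ s, Disjoint C (A i) := fun i hi =>
        disjoint_left.2 fun x hx hx' => (hCB hx).2 (mem_biUnion hi hx')
      intro i hi j hj hij
      simp only [Finset.coe_insert, mem_insert_iff, Finset.mem_coe] at hi hj
      rcases eq_or_ne i a with rfl | h <;> rcases eq_or_ne j i with rfl | h'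
      · exact absurd rfl hij
      · simpa [Function.onFun, h'] using key j (hj.resolve_left h')
      · exact absurd rfl hij
      · rcases eq_or_ne j a with rfl | h''
        · simpa [Function.onFun, h] using (key i (hi.resolve_left h)).symm
        · simpa [Function.onFun, h, h''] using hd (hi.resolve_left h) (hj.resolve_left h'') hij

/-- Transport between two sets of equal mass of an atomless measure. -/
lemma exists_measurable_map_restrict_eq {X : Type*} [MeasurableSpace X]
    [StandardBorelSpace X] (μ : Measure X) [IsFiniteMeasure μ] [NullSingletonClass μ] {A A' : Set X}
    (h0 : μ A ≠ 0) (h : μ A = μ A') :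
    ∃ r : X → X, Measurable r ∧ (μ.restrict A).map r = μ.restrict A' := by
  have htop := measure_ne_top μ A
  have hp : ∀ B : Set X, μ A = μ B → IsProbabilityMeasure ((μ A)⁻¹ • μ.restrict B) :=
    fun B hB => ⟨by simp [← hB, ENNReal.inv_mul_cancel h0 htop]⟩
  have := hp A rfl
  have := hp A' h
  have hna : NullSingletonClass ((μ A)⁻¹ • μ.restrict A) := ⟨fun x => by simp⟩
  -- The transport factors through the unit interval: `g` makes the source uniform, `k` realizes the
  -- target from a uniform variable.
  obtain ⟨g, hg, hgm⟩ := exists_measurable_map_eq_unitInterval_volume ((μ A)⁻¹ • μ.restrict A)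
  have : Nonempty X := by
    by_contra hX
    rw [not_nonempty_iff] at hX
    exact h0 (by rw [A.eq_empty_of_isEmpty, measure_empty])
  obtain ⟨k, hk, hkm⟩ := ((μ A)⁻¹ • μ.restrict A').exists_measurable_map_eq
  refine ⟨k ∘ g, hk.comp hg, ?_⟩
  rw [← Measure.map_map hk hg]
  rw [Measure.map_smul] at hgm
  have hres : (μ.restrict A).map g = μ A • volume := by
    rw [← hgm, smul_smul, ENNReal.mul_inv_cancel h0 htop, one_smul]
  rw [hres, Measure.map_smul, hkm, smul_smul, ENNReal.mul_inv_cancel h0 htop, one_smul]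

/-- A measure-preserving rearrangement which moves pieces of equal mass of given sets according to
a permutation, and fixes all other points. -/
lemma exists_measurePreserving_rearrangement {X ι : Type*} [MeasurableSpace X]
    [StandardBorelSpace X] [Fintype ι] [Nonempty ι] (μ : Measure X) [IsFiniteMeasure μ]
    [NullSingletonClass μ] {B : ι → Set X} (hB : ∀ i, MeasurableSet (B i))
    (h0 : ∀ i, μ (B i) ≠ 0) (σ : Equiv.Perm ι) :
    ∃ (A : ι → Set X) (m : ℝ≥0∞) (R : X → X), m ≠ 0 ∧ Measurable R ∧ μ.map R = μ ∧
      (∀ i, MeasurableSet (A i)) ∧ (∀ i, A i ⊆ B i) ∧ (∀ i, μ (A i) = m) ∧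
      Pairwise (Function.onFun Disjoint A) ∧ (∀ i, ∀ᵐ x ∂μ.restrict (A i), R x ∈ A (σ i)) ∧
      ∀ x ∉ ⋃ i, A i, R x = x := by
  obtain ⟨j, hj⟩ := Finite.exists_min fun i => μ (B i)
  have hc0 : (Finset.univ.card : ℝ≥0∞) * (μ (B j) / (Finset.univ : Finset ι).card) = μ (B j) :=
    ENNReal.mul_div_cancel (by simp) (by simp)
  set m := μ (B j) / (Finset.univ : Finset ι).card with hm
  have hm0 : m ≠ 0 := fun h => h0 j (by rw [← hc0, h, mul_zero])
  obtain ⟨A, hAB, hA, hAm, hd⟩ := exists_pairwiseDisjoint_subset_measure_eq μ hB m Finset.univ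
    fun i _ => hc0.le.trans (hj i)
  replace hAm : ∀ i, μ (A i) = m := fun i => hAm i (Finset.mem_univ i)
  have hd' : Pairwise (Function.onFun Disjoint A) := fun i k hik =>
    hd (by simp) (by simp) hik
  choose r hr hrm using fun i => exists_measurable_map_restrict_eq μ (A := A i) (A' := A (σ i))
    ((hAm i).trans_ne hm0) ((hAm i).trans (hAm _).symm)
  -- The index `none` stands for the complement of the pieces, where `R` is the identity;
  -- `Equiv.optionCongr σ` fixes it.
  let t : Option ι → Set X := fun o => o.elim (⋃ i, A i)ᶜ A
  have ht : ∀ o, MeasurableSet (t o) := fun o => by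
    cases o
    · exact (MeasurableSet.iUnion hA).compl
    · exact hA _
  have htd : Pairwise (Function.onFun Disjoint t) := by
    have key : ∀ i, Disjoint (⋃ i, A i)ᶜ (A i) := fun i =>
      disjoint_left.2 fun x hx hx' => hx (mem_iUnion.2 ⟨i, hx'⟩)
    intro o o' ho
    rcases o with _ | i <;> rcases o' with _ | k
    · exact absurd rfl ho
    · exact key k
    · exact (key i).symm
    · exact hd' fun h => ho (congrArg _ h)
  have htU : ⋃ o, t o = univ := by
    rw [iUnion_option]
    exact compl_union_self _
  obtain ⟨R, hR, hRt⟩ := exists_measurable_piecewise t ht (fun o => o.elim id r)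
    (fun o => by
      cases o
      · exact measurable_id
      · exact hr _)
    (fun o o' ho x hx => absurd hx.2 (disjoint_left.1 (htd ho) hx.1))
  have hmapt : ∀ o, (μ.restrict (t o)).map R = μ.restrict (t (Equiv.optionCongr σ o)) := by
    intro o
    rw [Measure.map_congr ((ae_restrict_iff' (ht o)).2 (Eventually.of_forall fun x hx => hRt o hx))]
    cases o
    · exact Measure.map_id
    · exact hrm _
  refine ⟨A, m, R, hm0, hR, ?_, hA, hAB, hAm, hd', fun i => ?_, fun x hx => hRt none hx⟩
  · have hs : μ = Measure.sum fun o => μ.restrict (t o) := by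
      rw [← Measure.restrict_iUnion htd ht, htU, Measure.restrict_univ]
    conv_lhs => rw [hs]
    rw [Measure.map_sum hR.aemeasurable]
    simp_rw [hmapt]
    conv_rhs => rw [hs]
    ext E hE
    rw [Measure.sum_apply _ hE, Measure.sum_apply _ hE]
    exact (Equiv.optionCongr σ).tsum_eq fun o => μ.restrict (t o) E
  · have h := hmapt (some i)
    have h2 : ∀ᵐ y ∂(μ.restrict (A i)).map R, y ∈ A (σ i) := by
      rw [show (μ.restrict (A i)).map R = μ.restrict (A (σ i)) from h]
      exact ae_restrict_mem (hA _)
    exact ae_of_ae_map hR.aemeasurable h2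

/-! ### Quadratic cost and correlation -/

lemma integrable_norm_sq_of_lintegral_enorm_sq_lt_top {F : Type*} [NormedAddCommGroup F]
    [MeasurableSpace F] [OpensMeasurableSpace F] [SecondCountableTopology F] {μ : Measure F}
    (hm : ∫⁻ x, ‖x‖ₑ ^ 2 ∂μ < ⊤) :
    Integrable (fun x : F => ‖x‖ ^ 2) μ := by
  refine ⟨(continuous_norm.pow 2).aestronglyMeasurable, ?_⟩
  simpa [HasFiniteIntegral, enorm_pow] using hm

lemma integrable_norm_of_integrable_norm_sq {F : Type*} [NormedAddCommGroup F]
    [MeasurableSpace F] [OpensMeasurableSpace F] [SecondCountableTopology F] {μ : Measure F}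
    [IsFiniteMeasure μ] (hm : Integrable (fun x : F => ‖x‖ ^ 2) μ) :
    Integrable (fun x : F => ‖x‖) μ := by
  refine (hm.add (integrable_const 1)).mono' continuous_norm.aestronglyMeasurable
    (Eventually.of_forall fun x => ?_)
  simp only [norm_norm, Pi.add_apply]
  nlinarith [sq_nonneg (‖x‖ - 1), norm_nonneg x]

lemma integrable_inner_of_ae_norm_le {F : Type*} [NormedAddCommGroup F] [InnerProductSpace ℝ F]
    [MeasurableSpace F] [BorelSpace F] [SecondCountableTopology F] {μ : Measure F}
    (hm : Integrable (fun x : F => ‖x‖) μ) {S : F → F} (hS : Measurable S) {M : ℝ}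
    (hM : ∀ᵐ x ∂μ, ‖S x‖ ≤ M) :
    Integrable (fun x => inner ℝ x (S x)) μ := by
  refine (hm.mul_const M).mono' (measurable_id.inner hS).aestronglyMeasurable ?_
  filter_upwards [hM] with x hx
  exact (norm_inner_le_norm _ _).trans (by gcongr)

section

variable {d : ℕ}

lemma ae_mem_support_of_map_eq {μ ν : Measure (EuclideanSpace ℝ (Fin d))}
    {S : EuclideanSpace ℝ (Fin d) → EuclideanSpace ℝ (Fin d)} (hS : Measurable S)
    (h : μ.map S = ν) : ∀ᵐ x ∂μ, S x ∈ ν.support :=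
  ae_of_ae_map (p := fun y => y ∈ ν.support) hS.aemeasurable (h ▸ Measure.support_mem_ae)

lemma exists_norm_le_of_map_eq {ν : Measure (EuclideanSpace ℝ (Fin d))}
    (hν : IsCompact ν.support) :
    ∃ M : ℝ, 0 ≤ M ∧ (∀ y ∈ ν.support, ‖y‖ ≤ M) ∧
      ∀ (μ : Measure (EuclideanSpace ℝ (Fin d)))
        (S : EuclideanSpace ℝ (Fin d) → EuclideanSpace ℝ (Fin d)), Measurable S → μ.map S = ν →
        ∀ᵐ x ∂μ, ‖S x‖ ≤ M := by
  obtain ⟨M, hM⟩ := hν.isBounded.exists_norm_le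
  refine ⟨max M 0, le_max_right _ _, fun y hy => (hM y hy).trans (le_max_left _ _),
    fun μ S hS h => ?_⟩
  filter_upwards [ae_mem_support_of_map_eq hS h] with x hx
  exact (hM _ hx).trans (le_max_left _ _)

/-- Expand the square: `∫ ‖S x‖²` depends on `ν` alone, so only the correlation varies with `S`.
Nonnegativity is recorded because `ENNReal.ofReal` truncates negative numbers. -/
lemma quadraticMongeCost_eq {μ ν : Measure (EuclideanSpace ℝ (Fin d))} [IsProbabilityMeasure μ]
    (hν : IsCompact ν.support) (hm : Integrable (fun x => ‖x‖ ^ 2) μ)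
    {S : EuclideanSpace ℝ (Fin d) → EuclideanSpace ℝ (Fin d)} (hS : Measurable S)
    (h : μ.map S = ν) :
    0 ≤ 1 / 2 * ∫ x, ‖x‖ ^ 2 ∂μ + 1 / 2 * ∫ y, ‖y‖ ^ 2 ∂ν - ∫ x, inner ℝ x (S x) ∂μ ∧
    quadraticMongeCost μ S = ENNReal.ofReal
      (1 / 2 * ∫ x, ‖x‖ ^ 2 ∂μ + 1 / 2 * ∫ y, ‖y‖ ^ 2 ∂ν - ∫ x, inner ℝ x (S x) ∂μ) := by
  obtain ⟨M, hM0, -, hM⟩ := exists_norm_le_of_map_eq hν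
  have hSM := hM μ S hS h
  have hi := integrable_inner_of_ae_norm_le (integrable_norm_of_integrable_norm_sq hm) hS hSM
  have hs : Integrable (fun x => ‖S x‖ ^ 2) μ := by
    refine (integrable_const (M ^ 2)).mono' (hS.norm.pow_const 2).aestronglyMeasurable ?_
    filter_upwards [hSM] with x hx
    rw [Real.norm_of_nonneg (by positivity)]
    gcongr
  have heq : ∀ x, (1 / 2 : ℝ) * ‖x - S x‖ ^ 2
      = 1 / 2 * ‖x‖ ^ 2 + 1 / 2 * ‖S x‖ ^ 2 - inner ℝ x (S x) := fun x => by
    rw [norm_sub_sq_real]; ring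
  have hval : ∫ x, (1 / 2 : ℝ) * ‖x - S x‖ ^ 2 ∂μ
      = 1 / 2 * ∫ x, ‖x‖ ^ 2 ∂μ + 1 / 2 * ∫ y, ‖y‖ ^ 2 ∂ν - ∫ x, inner ℝ x (S x) ∂μ := by
    have hadd : Integrable (fun x => (1 / 2 : ℝ) * ‖x‖ ^ 2 + 1 / 2 * ‖S x‖ ^ 2) μ :=
      (hm.const_mul _).add (hs.const_mul _)
    simp_rw [heq]
    rw [integral_sub hadd hi, integral_add (hm.const_mul _) (hs.const_mul _), integral_const_mul, integral_const_mul, ← h,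
      integral_map (f := fun y => ‖y‖ ^ 2) hS.aemeasurable
        (continuous_norm.pow 2).aestronglyMeasurable]
  rw [← hval]
  refine ⟨integral_nonneg fun x => by positivity, ?_⟩
  rw [quadraticMongeCost, ofReal_integral_eq_lintegral_ofReal _
    (Eventually.of_forall fun x => by positivity)]
  simp_rw [heq]
  exact ((hm.const_mul _).add (hs.const_mul _)).sub hi

/-- For maps with the same image measure, comparing quadratic costs amounts to comparing
correlations. -/
lemma quadraticMongeCost_le_iff {μ ν : Measure (EuclideanSpace ℝ (Fin d))}
    [IsProbabilityMeasure μ]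
    (hν : IsCompact ν.support) (hm : Integrable (fun x => ‖x‖ ^ 2) μ)
    {S S' : EuclideanSpace ℝ (Fin d) → EuclideanSpace ℝ (Fin d)} (hS : Measurable S)
    (h : μ.map S = ν) (hS' : Measurable S') (h' : μ.map S' = ν) :
    quadraticMongeCost μ S ≤ quadraticMongeCost μ S' ↔
      ∫ x, inner ℝ x (S' x) ∂μ ≤ ∫ x, inner ℝ x (S x) ∂μ := by
  obtain ⟨-, h1⟩ := quadraticMongeCost_eq hν hm hS h
  obtain ⟨h2, h3⟩ := quadraticMongeCost_eq hν hm hS' h'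
  rw [h1, h3, ENNReal.ofReal_le_ofReal_iff h2]
  constructor <;> intro <;> linarith

lemma quadraticMongeCost_eq_top {μ ν : Measure (EuclideanSpace ℝ (Fin d))}
    [IsProbabilityMeasure μ]
    (hν : IsCompact ν.support) (hm : ¬ Integrable (fun x => ‖x‖ ^ 2) μ)
    {S : EuclideanSpace ℝ (Fin d) → EuclideanSpace ℝ (Fin d)} (hS : Measurable S)
    (h : μ.map S = ν) : quadraticMongeCost μ S = ⊤ := by
  by_contra hne
  obtain ⟨M, hM0, -, hM⟩ := exists_norm_le_of_map_eq hν
  have hSM := hM μ S hS h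
  have hmeas : Measurable fun x => (1 / 2 : ℝ) * ‖x - S x‖ ^ 2 := by fun_prop
  have hc : Integrable (fun x => (1 / 2 : ℝ) * ‖x - S x‖ ^ 2) μ := by
    refine ⟨hmeas.aestronglyMeasurable, ?_⟩
    rw [hasFiniteIntegral_iff_ofReal (Eventually.of_forall fun x => by positivity)]
    exact lt_top_iff_ne_top.2 hne
  -- The constants come from `‖x‖² ≤ 2‖x - S x‖² + 2M²`.
  refine hm (((hc.const_mul 4).add (integrable_const (2 * M ^ 2))).mono'
    (continuous_norm.pow 2).aestronglyMeasurable ?_)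
  filter_upwards [hSM] with x hx
  rw [Real.norm_of_nonneg (by positivity)]
  have h1 : ‖x‖ ≤ ‖x - S x‖ + M := by
    have := norm_add_le (x - S x) (S x)
    rw [sub_add_cancel] at this
    linarith
  have h2 := pow_le_pow_left₀ (norm_nonneg x) h1 2
  simp only [Pi.add_apply]
  nlinarith [sq_nonneg (‖x - S x‖ - M)]

/-! ### Cyclic monotonicity and optimality -/

/-- An optimal map is cyclically monotone, in a form which uses sets of positive mass. -/
lemma IsOptimalMongeMap.sum_nonneg {μ ν : Measure (EuclideanSpace ℝ (Fin d))}
    [IsProbabilityMeasure μ] [NullSingletonClass μ]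
    (hν : IsCompact ν.support) (hm : Integrable (fun x => ‖x‖ ^ 2) μ)
    {f : EuclideanSpace ℝ (Fin d) → EuclideanSpace ℝ (Fin d)} (hf : IsOptimalMongeMap μ ν f)
    {ι : Type*} [Fintype ι] (σ : Equiv.Perm ι) {B : ι → Set (EuclideanSpace ℝ (Fin d))}
    (hB : ∀ i, MeasurableSet (B i)) (h0 : ∀ i, μ (B i) ≠ 0) (c : ι → ℝ)
    (hc : ∀ i, ∀ x ∈ B i, ∀ y ∈ B (σ i), inner ℝ x (f x - f y) ≤ c i) :
    0 ≤ ∑ i, c i := by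
  rcases isEmpty_or_nonempty ι with hι | hι
  · simp
  obtain ⟨A, m, R, hm0, hR, hRμ, hA, hAB, hAm, hd, hRA, hRid⟩ :=
    exists_measurePreserving_rearrangement μ hB h0 σ
  obtain ⟨hfm, hfν, hopt⟩ := hf
  -- The rearranged map is a competitor. It differs from `f` only on the pieces `A i`, where the
  -- loss is controlled by `c i`.
  have hfR : μ.map (f ∘ R) = ν := by rw [← Measure.map_map hfm hR, hRμ, hfν]
  have h1 := (quadraticMongeCost_le_iff hν hm hfm hfν (hfm.comp hR) hfR).1
    (hopt _ (hfm.comp hR) hfR)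
  obtain ⟨M, -, -, hM⟩ := exists_norm_le_of_map_eq hν
  have hm1 := integrable_norm_of_integrable_norm_sq hm
  have i1 := integrable_inner_of_ae_norm_le hm1 hfm (hM μ f hfm hfν)
  have i2 := integrable_inner_of_ae_norm_le hm1 (hfm.comp hR) (hM μ _ (hfm.comp hR) hfR)
  have i3 : Integrable (fun x => inner ℝ x (f x) - inner ℝ x ((f ∘ R) x)) μ := i1.sub i2
  have h2 : 0 ≤ ∫ x, (inner ℝ x (f x) - inner ℝ x ((f ∘ R) x)) ∂μ := by
    rw [integral_sub i1 i2]; linarith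
  have h3 : ∫ x, (inner ℝ x (f x) - inner ℝ x ((f ∘ R) x)) ∂μ
      = ∑ i, ∫ x in A i, (inner ℝ x (f x) - inner ℝ x ((f ∘ R) x)) ∂μ := by
    rw [← integral_iUnion_fintype hA hd fun i => i3.integrableOn]
    refine (setIntegral_eq_integral_of_forall_compl_eq_zero fun x hx => ?_).symm
    simp [hRid x hx]
  have hmt : m ≠ ⊤ := by
    obtain ⟨i⟩ := hι
    exact hAm i ▸ measure_ne_top _ _
  have h4 : ∀ i, ∫ x in A i, (inner ℝ x (f x) - inner ℝ x ((f ∘ R) x)) ∂μ ≤ m.toReal * c i := by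
    intro i
    have : ∫ x in A i, (inner ℝ x (f x) - inner ℝ x ((f ∘ R) x)) ∂μ ≤ ∫ x in A i, c i ∂μ := by
      refine integral_mono_ae i3.integrableOn (integrable_const _) ?_
      filter_upwards [hRA i, ae_restrict_mem (hA i)] with x hx hx'
      simp only [Function.comp]
      rw [← inner_sub_right]
      exact hc i x (hAB i hx') _ (hAB _ hx)
    refine this.trans_eq ?_
    rw [setIntegral_const, Measure.real, hAm, smul_eq_mul]
  have h5 : 0 ≤ m.toReal * ∑ i, c i := by
    rw [Finset.mul_sum]
    exact (h3 ▸ h2).trans (Finset.sum_le_sum fun i _ => h4 i)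
  exact nonneg_of_mul_nonneg_right h5 (ENNReal.toReal_pos hm0 hmt)

/-- Rockafellar's potential of a cyclically monotone map with bounded values. -/
lemma exists_lipschitzWith_potential {F : Type*} [NormedAddCommGroup F] [InnerProductSpace ℝ F]
    {S : Set F} (hne : S.Nonempty) {T : F → F} {M : NNReal} (hM : ∀ x ∈ S, ‖T x‖ ≤ M)
    (hcm : ∀ (n : ℕ) (c : ℕ → F), (∀ i, c i ∈ S) →
      ∑ i ∈ Finset.range n, inner ℝ (c (i + 1) - c i) (T (c i))
        + inner ℝ (c 0 - c n) (T (c n)) ≤ 0) :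
    ∃ u : F → ℝ, LipschitzWith M u ∧ ∀ a ∈ S, ∀ z, inner ℝ (z - a) (T a) + u a ≤ u z := by
  obtain ⟨x₀, hx₀⟩ := hne
  -- Chains in `S` starting at `x₀`; only the entries up to `p.1.1` matter. The potential is the
  -- supremum of the affine functions `P · p`, whose slopes are values of `T` on `S`, hence bounded
  -- by `M`.
  let I := {p : ℕ × (ℕ → F) // p.2 0 = x₀ ∧ ∀ i, p.2 i ∈ S}
  have : Nonempty I := ⟨⟨(0, fun _ => x₀), rfl, fun _ => hx₀⟩⟩
  let P : F → I → ℝ := fun z p =>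
    ∑ i ∈ Finset.range p.1.1, inner ℝ (p.1.2 (i + 1) - p.1.2 i) (T (p.1.2 i))
      + inner ℝ (z - p.1.2 p.1.1) (T (p.1.2 p.1.1))
  have hcs : ∀ (x : F) (p : I), inner ℝ x (T (p.1.2 p.1.1)) ≤ M * ‖x‖ := fun x p =>
    (real_inner_le_norm _ _).trans (by
      rw [mul_comm]; gcongr; exact hM _ (p.2.2 _))
  have hbd : ∀ z, BddAbove (range (P z)) := by
    refine fun z => ⟨M * ‖z - x₀‖, ?_⟩
    rintro _ ⟨p, rfl⟩
    refine le_trans ?_ (hcs (z - x₀) p)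
    -- Closing the chain at `x₀` gives `P x₀ p ≤ 0`, so the supremum is finite.
    have h1 := hcm p.1.1 p.1.2 p.2.2
    rw [p.2.1] at h1
    have h2 : inner ℝ (z - x₀) (T (p.1.2 p.1.1))
        = inner ℝ (z - p.1.2 p.1.1) (T (p.1.2 p.1.1))
          - inner ℝ (x₀ - p.1.2 p.1.1) (T (p.1.2 p.1.1)) := by
      rw [← inner_sub_left]; congr 1; abel
    simp only [P]
    linarith
  refine ⟨fun z => ⨆ p, P z p, LipschitzWith.of_le_add_mul _ fun x y => ciSup_le fun p => ?_,
    fun a ha z => ?_⟩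
  · have h1 := le_ciSup (hbd y) p
    have h2 := hcs (x - y) p
    have h3 : P x p = P y p + inner ℝ (x - y) (T (p.1.2 p.1.1)) := by
      simp only [P]
      rw [add_assoc, ← inner_add_left]
      congr 2
      abel
    rw [dist_eq_norm]
    linarith
  · rw [← le_sub_iff_add_le']
    refine ciSup_le fun p => ?_
    rw [le_sub_iff_add_le']
    -- Appending `a` to a chain gives a chain admissible in the supremum at `z`.
    let c : ℕ → F := fun i => if i ≤ p.1.1 then p.1.2 i else a
    have hc : ∀ i ≤ p.1.1, c i = p.1.2 i := fun i hi => if_pos hi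
    have hc' : c (p.1.1 + 1) = a := if_neg (by simp)
    have hcI : c 0 = x₀ ∧ ∀ i, c i ∈ S := by
      refine ⟨(hc 0 (Nat.zero_le _)).trans p.2.1, fun i => ?_⟩
      by_cases h : i ≤ p.1.1
      · rw [hc i h]; exact p.2.2 i
      · simpa [c, h] using ha
    refine le_trans (le_of_eq ?_) (le_ciSup (hbd z) ⟨(p.1.1 + 1, c), hcI⟩)
    simp only [P]
    rw [Finset.sum_range_succ, hc', hc _ le_rfl, add_comm]
    congr 2
    refine Finset.sum_congr rfl fun i hi => ?_
    rw [hc i (Finset.mem_range.1 hi).le, hc _ (Finset.mem_range.1 hi)]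

/-- A continuous transport map whose graph over the support is cyclically monotone is optimal. -/
lemma isOptimalMongeMap_of_cyclicallyMonotone {μ ν : Measure (EuclideanSpace ℝ (Fin d))}
    [IsProbabilityMeasure μ] (hν : IsCompact ν.support)
    {T : EuclideanSpace ℝ (Fin d) → EuclideanSpace ℝ (Fin d)} (hT : Continuous T)
    (hTν : μ.map T = ν)
    (hcm : ∀ (n : ℕ) (c : ℕ → EuclideanSpace ℝ (Fin d)), (∀ i, c i ∈ μ.support) →
      ∑ i ∈ Finset.range n, inner ℝ (c (i + 1) - c i) (T (c i))
        + inner ℝ (c 0 - c n) (T (c n)) ≤ 0) :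
    IsOptimalMongeMap μ ν T := by
  refine ⟨hT.measurable, hTν, fun S hS hSν => ?_⟩
  by_cases hm : Integrable (fun x => ‖x‖ ^ 2) μ
  swap
  · rw [quadraticMongeCost_eq_top hν hm hS hSν]
    exact le_top
  rw [quadraticMongeCost_le_iff hν hm hT.measurable hTν hS hSν]
  obtain ⟨M, hM0, hMs, hM⟩ := exists_norm_le_of_map_eq hν
  have hsub : ∀ x ∈ μ.support, T x ∈ ν.support := by
    intro x hx
    rw [Measure.mem_support_iff_forall] at hx ⊢
    intro U hU
    refine (hx (T ⁻¹' U) (hT.continuousAt hU)).trans_le ?_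
    rw [← hTν]
    exact Measure.le_map_apply hT.measurable.aemeasurable U
  have hne : μ.support.Nonempty := Measure.nonempty_support (IsProbabilityMeasure.ne_zero μ)
  obtain ⟨u, hu, hineq⟩ := exists_lipschitzWith_potential (M := ⟨M, hM0⟩) hne
    (fun x hx => hMs _ (hsub x hx)) hcm
  have hm1 := integrable_norm_of_integrable_norm_sq hm
  have hui : Integrable u μ := by
    refine ((integrable_const |u 0|).add (hm1.const_mul M)).mono'
      hu.continuous.aestronglyMeasurable (Eventually.of_forall fun x => ?_)
    have h1 := hu.dist_le_mul x 0
    rw [Real.dist_eq, dist_zero_right] at h1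
    change |u x - u 0| ≤ M * ‖x‖ at h1
    have h2 := abs_sub_abs_le_abs_sub (u x) (u 0)
    simp only [Pi.add_apply, Real.norm_eq_abs]
    linarith
  let z := TopologicalSpace.denseSeq (EuclideanSpace ℝ (Fin d))
  have hz : DenseRange z := TopologicalSpace.denseRange_denseSeq _
  -- The convex conjugate of `u`. The supremum over a dense sequence keeps it measurable; it is only
  -- meaningful where the family is bounded above, since a real `⨆` is otherwise `0`.
  let v : EuclideanSpace ℝ (Fin d) → ℝ := fun y => ⨆ n, (inner ℝ (z n) y - u (z n))
  have hvm : Measurable v := Measurable.iSup fun n => by fun_prop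
  have hbd : ∀ a ∈ μ.support, ∀ x, inner ℝ x (T a) - u x ≤ inner ℝ a (T a) - u a := by
    intro a ha x
    have := hineq a ha x
    rw [inner_sub_left] at this
    linarith
  have hbdd : ∀ a ∈ μ.support, BddAbove (range fun n => inner ℝ (z n) (T a) - u (z n)) := by
    rintro a ha
    refine ⟨inner ℝ a (T a) - u a, ?_⟩
    rintro _ ⟨n, rfl⟩
    exact hbd a ha _
  have hge : ∀ y, BddAbove (range fun n => inner ℝ (z n) y - u (z n)) → ∀ x,
      inner ℝ x y - u x ≤ v y := by
    intro y hy x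
    have hcl : IsClosed {x | inner ℝ x y - u x ≤ v y} :=
      isClosed_le ((continuous_id.inner continuous_const).sub hu.continuous) continuous_const
    have : closure (range z) ⊆ {x | inner ℝ x y - u x ≤ v y} := by
      refine closure_minimal ?_ hcl
      rintro _ ⟨n, rfl⟩
      exact le_ciSup hy n
    exact this (hz x)
  have hvT : ∀ a ∈ μ.support, v (T a) = inner ℝ a (T a) - u a := fun a ha =>
    le_antisymm (ciSup_le fun n => hbd a ha _) (hge _ (hbdd a ha) a)
  have hsupp : ∀ᵐ x ∂μ, x ∈ μ.support := Measure.support_mem_ae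
  have hiT := integrable_inner_of_ae_norm_le hm1 hT.measurable (hM μ T hT.measurable hTν)
  have hiS := integrable_inner_of_ae_norm_le hm1 hS (hM μ S hS hSν)
  have hvTi : Integrable (fun x => v (T x)) μ := by
    refine (hiT.sub hui).congr ?_
    filter_upwards [hsupp] with x hx
    exact (hvT x hx).symm
  have hvν : Integrable v ν := by
    rw [← hTν, integrable_map_measure hvm.aestronglyMeasurable hT.measurable.aemeasurable]
    exact hvTi
  have hvSi : Integrable (fun x => v (S x)) μ := by
    rw [← hSν, integrable_map_measure hvm.aestronglyMeasurable hS.aemeasurable] at hvν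
    exact hvν
  have hvS : ∫ x, v (S x) ∂μ = ∫ x, v (T x) ∂μ := by
    rw [← integral_map hS.aemeasurable hvm.aestronglyMeasurable,
      ← integral_map hT.measurable.aemeasurable hvm.aestronglyMeasurable, hSν, hTν]
  have hBν : ∀ᵐ y ∂ν, BddAbove (range fun n => inner ℝ (z n) y - u (z n)) := by
    have hms : MeasurableSet {y | BddAbove (range fun n => inner ℝ (z n) y - u (z n))} :=
      measurableSet_bddAbove_range fun n => by fun_prop
    rw [← hTν, ae_map_iff hT.measurable.aemeasurable hms]
    filter_upwards [hsupp] with x hx using hbdd x hx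
  have hBS : ∀ᵐ x ∂μ, BddAbove (range fun n => inner ℝ (z n) (S x) - u (z n)) :=
    ae_of_ae_map (p := fun y => BddAbove (range fun n => inner ℝ (z n) y - u (z n)))
      hS.aemeasurable (hSν ▸ hBν)
  -- Fenchel–Young inequality, with equality along the graph of `T`; `∫ v` is the same for both maps
  -- as they share the image `ν`.
  calc ∫ x, inner ℝ x (S x) ∂μ ≤ ∫ x, (u x + v (S x)) ∂μ := by
        refine integral_mono_ae hiS (hui.add hvSi) ?_
        filter_upwards [hBS] with x hx
        linarith [hge _ hx x]
    _ = ∫ x, (u x + v (T x)) ∂μ := by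
        rw [integral_add hui hvSi, integral_add hui hvTi, hvS]
    _ = ∫ x, inner ℝ x (T x) ∂μ := by
        refine integral_congr_ae ?_
        filter_upwards [hsupp] with x hx
        rw [hvT x hx]
        ring

/-! ### From bounded weak gradients to Lipschitz representatives -/

open scoped Convolution in
/-- The mollification of a map with bounded weak gradient has a bounded derivative. -/
lemma IsWeakGradientOn.exists_hasFDerivAt_normed_convolution
    {Ω K : Set (EuclideanSpace ℝ (Fin d))}
    {T : EuclideanSpace ℝ (Fin d) → EuclideanSpace ℝ (Fin d)}
    {G : EuclideanSpace ℝ (Fin d) → (EuclideanSpace ℝ (Fin d) →L[ℝ] EuclideanSpace ℝ (Fin d))}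
    (h : IsWeakGradientOn Ω T G) (hΩ : MeasurableSet Ω) (hK : MeasurableSet K) (hKΩ : K ⊆ Ω)
    (hKT : IntegrableOn T K) {C : NNReal} (hC : eLpNorm G ∞ (volume.restrict Ω) ≤ C)
    (ρ : ContDiffBump (0 : EuclideanSpace ℝ (Fin d)))
    {x : EuclideanSpace ℝ (Fin d)} (hx : Metric.closedBall x ρ.rOut ⊆ K) :
    ∃ D : EuclideanSpace ℝ (Fin d) →L[ℝ] EuclideanSpace ℝ (Fin d), ‖D‖₊ ≤ C ∧
      HasFDerivAt (ρ.normed volume ⋆[ContinuousLinearMap.lsmul ℝ ℝ, volume] (K.indicator T))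
        D x := by
  have hloc : LocallyIntegrable (K.indicator T) volume :=
    (hKT.integrable_indicator hK).locallyIntegrable
  have hcs : HasCompactSupport (ρ.normed volume) := ρ.hasCompactSupport_normed
  have hcd : ContDiff ℝ ∞ (ρ.normed volume) := ρ.contDiff_normed
  have hder := hcs.hasFDerivAt_convolution_left (ContinuousLinearMap.lsmul ℝ ℝ)
    (hcd.of_le (by exact_mod_cast le_top)) hloc x
  refine ⟨_, ?_, hder⟩
  refine ContinuousLinearMap.opNorm_le_bound _ C.2 fun v => ?_
  have hex := (hcs.fderiv ℝ).convolutionExists_left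
    ((ContinuousLinearMap.lsmul ℝ ℝ).precompL (EuclideanSpace ℝ (Fin d)))
    (hcd.continuous_fderiv (by simp)) hloc x
  -- Testing the weak gradient with `ρ (x - ·)` moves the derivative from the kernel to `T`, so the
  -- derivative of the mollification is an average of `G`.
  let φ : EuclideanSpace ℝ (Fin d) → ℝ := fun t => ρ.normed volume (x - t)
  have hφsupp : ∀ t, t ∉ Metric.closedBall x ρ.rOut → x - t ∉ tsupport (ρ.normed volume) := by
    intro t ht
    rw [ρ.tsupport_normed_eq]
    simpa [dist_eq_norm, norm_sub_rev] using ht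
  have hφ0 : ∀ t, t ∉ Metric.closedBall x ρ.rOut → φ t = 0 := fun t ht =>
    image_eq_zero_of_notMem_tsupport (f := ρ.normed volume) (hφsupp t ht)
  have hφts : tsupport φ ⊆ Metric.closedBall x ρ.rOut :=
    closure_minimal (fun t ht => by
      by_contra hn
      exact ht (hφ0 t hn)) Metric.isClosed_closedBall
  have hφcs : HasCompactSupport φ :=
    HasCompactSupport.of_support_subset_isCompact (isCompact_closedBall x ρ.rOut)
      ((subset_tsupport _).trans hφts)
  have hφcd : ContDiff ℝ ∞ φ := hcd.comp (contDiff_const.sub contDiff_id)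
  have hφd : ∀ t, fderiv ℝ φ t v = - fderiv ℝ (ρ.normed volume) (x - t) v := by
    intro t
    have h1 : HasFDerivAt (fun t => x - t)
        (-ContinuousLinearMap.id ℝ (EuclideanSpace ℝ (Fin d))) t :=
      (hasFDerivAt_id t).const_sub x
    have h2 : HasFDerivAt (ρ.normed volume) (fderiv ℝ (ρ.normed volume) (x - t)) (x - t) :=
      (hcd.differentiable (by simp) _).hasFDerivAt
    have h3 : HasFDerivAt φ _ t := h2.comp t h1
    rw [h3.fderiv]
    simp
  have hw := h.2.2 φ hφcd hφcs (hφts.trans (hx.trans hKΩ)) v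
  have heq : ((fderiv ℝ (ρ.normed volume) ⋆[(ContinuousLinearMap.lsmul ℝ ℝ).precompL
      (EuclideanSpace ℝ (Fin d)), volume] (K.indicator T)) x) v
      = ∫ t in Ω, φ t • G t v := by
    rw [convolution_eq_swap, ContinuousLinearMap.integral_apply hex.integrable_swap,
      ← neg_inj, ← hw, ← integral_neg,
      ← setIntegral_eq_integral_of_forall_compl_eq_zero (s := Ω)]
    · refine setIntegral_congr_fun hΩ fun t _ => ?_
      simp only [ContinuousLinearMap.precompL_apply, ContinuousLinearMap.lsmul_apply, hφd,
        neg_smul]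
      by_cases ht : t ∈ K
      · rw [indicator_of_mem ht]
      · have : fderiv ℝ (ρ.normed volume) (x - t) = 0 := by
          by_contra hne
          exact hφsupp t (fun h' => ht (hx h')) (support_fderiv_subset ℝ hne)
        simp [this]
    · intro t ht
      simp [indicator_of_notMem fun h' => ht (hKΩ h')]
  rw [heq]
  have hGae : ∀ᵐ t ∂volume.restrict Ω, ‖G t‖ ≤ C := by
    rw [eLpNorm_exponent_top] at hC
    filter_upwards [ae_le_eLpNormEssSup (f := G) (μ := volume.restrict Ω)] with t ht
    exact_mod_cast enorm_le_coe.1 (ht.trans hC)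
  have hφi : Integrable φ := hφcd.continuous.integrable_of_hasCompactSupport hφcs
  have hφn : ∀ t, 0 ≤ φ t := fun t => ρ.nonneg_normed _
  calc ‖∫ t in Ω, φ t • G t v‖ ≤ ∫ t in Ω, φ t * (C * ‖v‖) := by
        refine norm_integral_le_of_norm_le (hφi.integrableOn.mul_const _) ?_
        filter_upwards [hGae] with t ht
        rw [norm_smul, Real.norm_of_nonneg (hφn t)]
        exact mul_le_mul_of_nonneg_left
          (((G t).le_opNorm v).trans (by gcongr)) (hφn t)
    _ = (∫ t in Ω, φ t) * (C * ‖v‖) := integral_mul_const _ _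
    _ ≤ 1 * (C * ‖v‖) := by
        gcongr
        calc ∫ t in Ω, φ t ≤ ∫ t, φ t :=
              setIntegral_le_integral hφi (Eventually.of_forall hφn)
          _ = 1 := by
              rw [integral_sub_left_eq_self (fun t => ρ.normed volume t) volume x]
              exact ρ.integral_normed
    _ = C * ‖v‖ := one_mul _

/-- A map with a bounded weak gradient on a ball is Lipschitz almost everywhere. -/
lemma IsWeakGradientOn.exists_lipschitzOnWith {R R' : ℝ} (hR : R' < R)
    {T : EuclideanSpace ℝ (Fin d) → EuclideanSpace ℝ (Fin d)}
    {G : EuclideanSpace ℝ (Fin d) → (EuclideanSpace ℝ (Fin d) →L[ℝ] EuclideanSpace ℝ (Fin d))}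
    (h : IsWeakGradientOn (Metric.ball 0 R) T G) {C : NNReal}
    (hC : eLpNorm G ∞ (volume.restrict (Metric.ball 0 R)) ≤ C) :
    ∃ E : Set (EuclideanSpace ℝ (Fin d)), (∀ᵐ x, x ∈ E) ∧
      LipschitzOnWith C T (E ∩ Metric.ball 0 R') := by
  -- The radius midway between `R'` and `R` leaves a margin `(R - R') / 2` for the mollifier.
  set K := Metric.closedBall (0 : EuclideanSpace ℝ (Fin d)) ((R' + R) / 2) with hKdef
  have hKΩ : K ⊆ Metric.ball 0 R := Metric.closedBall_subset_ball (by linarith)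
  have hKT : IntegrableOn T K :=
    h.1.integrableOn_compact_subset hKΩ (isCompact_closedBall _ _)
  have hloc : LocallyIntegrable (K.indicator T) volume :=
    (hKT.integrable_indicator measurableSet_closedBall).locallyIntegrable
  -- Shrinking bumps with a fixed ratio of radii, as required for almost everywhere convergence.
  let ρ : ℕ → ContDiffBump (0 : EuclideanSpace ℝ (Fin d)) := fun n =>
    ⟨1 / ((n : ℝ) + 1), 2 / ((n : ℝ) + 1), by positivity, by gcongr; norm_num⟩
  have hρ : Tendsto (fun n => (ρ n).rOut) atTop (𝓝 0) := by
    have := (tendsto_one_div_add_atTop_nhds_zero_nat (𝕜 := ℝ)).const_mul 2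
    simpa [ρ, div_eq_mul_inv] using this
  have hae := ContDiffBump.ae_convolution_tendsto_right_of_locallyIntegrable (μ := volume)
    (K := 2) hρ (Eventually.of_forall fun n => by simp [ρ, div_eq_mul_inv]) hloc
  refine ⟨{x | Tendsto _ _ _}, hae, LipschitzOnWith.of_dist_le_mul ?_⟩
  rintro x ⟨hxE, hx⟩ y ⟨hyE, hy⟩
  have hind : ∀ z ∈ Metric.ball (0 : EuclideanSpace ℝ (Fin d)) R', K.indicator T z = T z := by
    intro z hz
    refine indicator_of_mem ?_ _
    simp only [Metric.mem_ball, hKdef, Metric.mem_closedBall] at hz ⊢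
    linarith
  rw [← hind x hx, ← hind y hy]
  refine le_of_tendsto (Tendsto.dist hxE hyE) ?_
  filter_upwards [hρ.eventually (gt_mem_nhds (show (0 : ℝ) < (R - R') / 2 by linarith))] with n hn
  have hball : ∀ z ∈ Metric.ball (0 : EuclideanSpace ℝ (Fin d)) R',
      Metric.closedBall z (ρ n).rOut ⊆ K := by
    intro z hz
    refine Metric.closedBall_subset_closedBall' ?_
    rw [Metric.mem_ball] at hz
    linarith
  choose! D hD hD' using fun z hz =>
    h.exists_hasFDerivAt_normed_convolution Metric.isOpen_ball.measurableSet
      measurableSet_closedBall hKΩ hKT hC (ρ n) (hball z hz)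
  exact ((convex_ball _ _).lipschitzOnWith_of_nnnorm_hasFDerivWithin_le
    (fun z hz => (hD' z hz).hasFDerivWithinAt) hD).dist_le_mul x hx y hy

/-- A locally Lipschitz map on a dense set extends to the whole space. -/
lemma exists_continuous_extension {X Y : Type*} [PseudoMetricSpace X]
    [MetricSpace Y] [CompleteSpace Y] {E : Set X} (hE : Dense E) {T : X → Y} (x₀ : X)
    {C : ℕ → NNReal} (hC : ∀ n : ℕ, LipschitzOnWith (C n) T (E ∩ Metric.ball x₀ n)) :
    ∃ f : X → Y, EqOn f T E ∧ ∀ n : ℕ, LipschitzOnWith (C n) f (Metric.ball x₀ n) := by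
  have hlim : ∀ x, ∃ y, Tendsto T (𝓝[E] x) (𝓝 y) := by
    intro x
    obtain ⟨n, hn⟩ := exists_nat_gt (dist x x₀)
    have hne : (𝓝[E] x).NeBot := mem_closure_iff_nhdsWithin_neBot.1 (hE x)
    refine cauchy_map_iff_exists_tendsto.1 ?_
    have heq : 𝓝[E ∩ Metric.ball x₀ n] x = 𝓝[E] x :=
      nhdsWithin_inter_of_mem' (mem_nhdsWithin_of_mem_nhds (Metric.isOpen_ball.mem_nhds hn))
    have hca : Cauchy (𝓝[E ∩ Metric.ball x₀ n] x) :=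
      cauchy_nhds.mono' (heq ▸ hne) nhdsWithin_le_nhds
    rw [← heq]
    exact hca.map_of_le (hC n).uniformContinuousOn inf_le_right
  have hTE : ContinuousOn T E := by
    intro x hx
    obtain ⟨y, hy⟩ := hlim x
    have : T x = y := tendsto_nhds_unique
      (tendsto_pure_nhds T x) (hy.mono_left (pure_le_nhdsWithin hx))
    rw [← this] at hy
    exact hy
  refine ⟨extendFrom E T, extendFrom_extends hTE, fun n => ?_⟩
  have hcont := continuous_extendFrom hE hlim
  have h1 : LipschitzOnWith (C n) (extendFrom E T) (E ∩ Metric.ball x₀ n) := by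
    intro x hx y hy
    rw [extendFrom_extends hTE x hx.1, extendFrom_extends hTE y hy.1]
    exact hC n hx hy
  refine (h1.closure hcont.continuousOn).mono ?_
  rw [inter_comm]
  exact hE.open_subset_closure_inter Metric.isOpen_ball

lemma exists_isWeakGradientOn_of_gradLinftyNorm_lt {Ω : Set (EuclideanSpace ℝ (Fin d))}
    {T : EuclideanSpace ℝ (Fin d) → EuclideanSpace ℝ (Fin d)} {C : ℝ≥0∞}
    (h : gradLinftyNorm Ω T < C) :
    ∃ G, IsWeakGradientOn Ω T G ∧ eLpNorm G ∞ (volume.restrict Ω) < C := by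
  simpa [gradLinftyNorm, iInf_lt_iff] using h

/-- If the gradient of a map is bounded on every ball, the map agrees almost everywhere with a
locally Lipschitz one, with the same bounds. -/
lemma exists_lipschitzOnWith_ae_eq {T : EuclideanSpace ℝ (Fin d) → EuclideanSpace ℝ (Fin d)}
    {C : ℕ → NNReal} (hC : ∀ n : ℕ, gradLinftyNorm (Metric.ball 0 (n + 1)) T < C n) :
    ∃ f : EuclideanSpace ℝ (Fin d) → EuclideanSpace ℝ (Fin d),
      f =ᵐ[volume] T ∧ ∀ n : ℕ, LipschitzOnWith (C n) f (Metric.ball 0 n) := by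
  choose G hG hGC using fun n => exists_isWeakGradientOn_of_gradLinftyNorm_lt (hC n)
  choose E hE hL using fun n : ℕ =>
    (hG n).exists_lipschitzOnWith (lt_add_one (n : ℝ)) (hGC n).le
  have hEae : ∀ᵐ x, x ∈ ⋂ n, E n := by
    simpa only [mem_iInter] using ae_all_iff.2 hE
  obtain ⟨f, hf, hfL⟩ := exists_continuous_extension (Measure.dense_of_ae hEae) 0
    (fun n => (hL n).mono (inter_subset_inter_left _ (iInter_subset E n)))
  exact ⟨f, hEae.mono fun x hx => hf hx, hfL⟩

/-! ### Limits of optimal maps -/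

/-- A common Lipschitz constant upgrades pointwise to continuous convergence, the form that
tolerates base points moving with the measures. -/
lemma tendsto_prod_nhds_of_lipschitzOnWith {ι X Y : Type*} [PseudoMetricSpace X]
    [PseudoMetricSpace Y] {l : Filter ι} {F : ι → X → Y} {f : X → Y} {s : Set X} {C : NNReal}
    (hF : ∀ᶠ i in l, LipschitzOnWith C (F i) s) {x : X} (hs : s ∈ 𝓝 x)
    (hf : Tendsto (fun i => F i x) l (𝓝 (f x))) :
    Tendsto (fun p : ι × X => F p.1 p.2) (l ×ˢ 𝓝 x) (𝓝 (f x)) := by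
  rw [tendsto_iff_dist_tendsto_zero]
  have h1 : Tendsto (fun p : ι × X => C * dist p.2 x + dist (F p.1 x) (f x)) (l ×ˢ 𝓝 x)
      (𝓝 (C * 0 + 0)) :=
    ((tendsto_iff_dist_tendsto_zero.1 (tendsto_snd (f := l) (g := 𝓝 x))).const_mul _).add
      ((tendsto_iff_dist_tendsto_zero.1 hf).comp tendsto_fst)
  rw [mul_zero, add_zero] at h1
  refine squeeze_zero' (Eventually.of_forall fun _ => dist_nonneg) ?_ h1
  filter_upwards [hF.prod_mk (show ∀ᶠ y in 𝓝 x, y ∈ s from hs)] with p hp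
  exact (dist_triangle _ (F p.1 x) _).trans
    (by gcongr; exact hp.1.dist_le_mul _ hp.2 _ (mem_of_mem_nhds hs))

lemma lipschitzOnWith_of_tendsto {ι X Y : Type*} [PseudoMetricSpace X]
    [PseudoMetricSpace Y] {l : Filter ι} [l.NeBot] {F : ι → X → Y} {f : X → Y} {s : Set X}
    {C : NNReal} (hF : ∀ᶠ i in l, LipschitzOnWith C (F i) s)
    (hf : ∀ x ∈ s, Tendsto (fun i => F i x) l (𝓝 (f x))) : LipschitzOnWith C f s := by
  refine LipschitzOnWith.of_dist_le_mul fun x hx y hy => ?_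
  refine le_of_tendsto ((hf x hx).dist (hf y hy)) ?_
  filter_upwards [hF] with i hi using hi.dist_le_mul x hx y hy

/-- Weak limits of measures charge the neighbourhoods of points of the support of the limit
eventually. -/
lemma eventually_measure_pos_of_mem_support {ι X : Type*} [TopologicalSpace X]
    [MeasurableSpace X] [OpensMeasurableSpace X] [HasOuterApproxClosed X] {l : Filter ι}
    {μs : ι → ProbabilityMeasure X} {μ : ProbabilityMeasure X} (h : Tendsto μs l (𝓝 μ))
    {x : X} (hx : x ∈ (μ : Measure X).support) {U : Set X} (hU : IsOpen U) (hxU : x ∈ U) :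
    ∀ᶠ i in l, 0 < (μs i : Measure X) U :=
  eventually_lt_of_lt_liminf (((Measure.mem_support_iff_forall _).1 hx U (hU.mem_nhds hxU)).trans_le
    (ProbabilityMeasure.le_liminf_measure_open_of_tendsto h hU))

/-- If `F i → f` continuously and `μs i → μ` weakly, then the image measures have the expected
limit. -/
lemma map_eq_of_tendsto {ι X Y : Type*} [TopologicalSpace X] [TopologicalSpace Y]
    [MeasurableSpace X] [BorelSpace X] [HasOuterApproxClosed X] [MeasurableSpace Y] [BorelSpace Y]
    {l : Filter ι} [l.NeBot] {μs : ι → ProbabilityMeasure X} {μ : ProbabilityMeasure X}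
    (h : Tendsto μs l (𝓝 μ)) {F : ι → X → Y} {f : X → Y} (hf : Continuous f)
    [(μ : Measure X).InnerRegularCompactLTTop]
    {ν : Measure Y} [IsProbabilityMeasure ν] [ν.OuterRegular]
    (hF : ∀ x, Tendsto (fun p : ι × X => F p.1 p.2) (l ×ˢ 𝓝 x) (𝓝 (f x)))
    (hν : ∀ᶠ i in l, Measurable (F i) ∧ (μs i : Measure X).map (F i) = ν) :
    (μ : Measure X).map f = ν := by
  have hopen : ∀ U : Set Y, IsOpen U → (μ : Measure X).map f U ≤ ν U := by
    intro U hU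
    rw [Measure.map_apply hf.measurable hU.measurableSet,
      (hU.preimage hf).measurableSet.measure_eq_iSup_isCompact_of_ne_top (measure_ne_top _ _)]
    refine iSup_le fun K => iSup_le fun hKU => iSup_le fun hK => ?_
    -- Compactness turns the local convergence into one neighbourhood `V` of `K` that is eventually
    -- mapped into `U`; the portmanteau inequality applies to `V`.
    have hV : ∃ V : Set X, IsOpen V ∧ K ⊆ V ∧ ∀ᶠ i in l, MapsTo (F i) V U := by
      refine hK.induction_on (p := fun K => ∃ V : Set X, IsOpen V ∧ K ⊆ V ∧
        ∀ᶠ i in l, MapsTo (F i) V U) ⟨∅, isOpen_empty, Subset.rfl,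
          Eventually.of_forall fun i => mapsTo_empty _ _⟩
        (fun s t hst ⟨V, h1, h2, h3⟩ => ⟨V, h1, hst.trans h2, h3⟩)
        (fun s t ⟨V, h1, h2, h3⟩ ⟨W, h4, h5, h6⟩ => ⟨V ∪ W, h1.union h4, union_subset_union h2 h5,
          (h3.and h6).mono fun i hi => hi.1.union hi.2⟩) fun x hx => ?_
      obtain ⟨pa, hpa, pb, hpb, hp⟩ :=
        eventually_prod_iff.1 ((hF x).eventually (hU.mem_nhds (hKU hx)))
      obtain ⟨V, hVp, hV, hxV⟩ := mem_nhds_iff.1 hpb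
      exact ⟨V, mem_nhdsWithin_of_mem_nhds (hV.mem_nhds hxV), V, hV, Subset.rfl,
        hpa.mono fun i hi y hy => hp hi (hVp hy)⟩
    obtain ⟨V, hV, hKV, hVU⟩ := hV
    calc (μ : Measure X) K ≤ (μ : Measure X) V := measure_mono hKV
      _ ≤ l.liminf fun i => (μs i : Measure X) V :=
        ProbabilityMeasure.le_liminf_measure_open_of_tendsto h hV
      _ ≤ l.liminf fun _ => ν U := by
        refine liminf_le_liminf ?_
        filter_upwards [hVU, hν] with i hi hi'
        rw [← hi'.2, Measure.map_apply hi'.1 hU.measurableSet]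
        exact measure_mono hi
      _ = ν U := liminf_const _
  have : IsProbabilityMeasure ((μ : Measure X).map f) :=
    Measure.isProbabilityMeasure_map hf.measurable.aemeasurable
  have hle : (μ : Measure X).map f ≤ ν := Measure.le_intro fun A _ _ => by
    rw [A.measure_eq_iInf_isOpen ν]
    exact le_iInf fun U => le_iInf fun hAU => le_iInf fun hU => (measure_mono hAU).trans (hopen U hU)
  -- An inequality between measures of equal total mass is an equality.
  exact Measure.eq_of_le_of_isProbabilityMeasure hle

/-- A locally uniformly Lipschitz limit of optimal maps is cyclically monotone. -/
lemma cyclicallyMonotone_of_tendsto {ι : Type*} {l : Filter ι} [l.NeBot]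
    {μs : ι → ProbabilityMeasure (EuclideanSpace ℝ (Fin d))}
    {μ : ProbabilityMeasure (EuclideanSpace ℝ (Fin d))} (h : Tendsto μs l (𝓝 μ))
    {ν : Measure (EuclideanSpace ℝ (Fin d))} (hν : IsCompact ν.support)
    {F : ι → EuclideanSpace ℝ (Fin d) → EuclideanSpace ℝ (Fin d)}
    {f : EuclideanSpace ℝ (Fin d) → EuclideanSpace ℝ (Fin d)}
    (hF : ∀ x, Tendsto (fun p : ι × EuclideanSpace ℝ (Fin d) => F p.1 p.2) (l ×ˢ 𝓝 x)
      (𝓝 (f x)))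
    (hopt : ∀ᶠ i in l, NullSingletonClass (μs i : Measure (EuclideanSpace ℝ (Fin d))) ∧
      Integrable (fun x => ‖x‖ ^ 2) (μs i : Measure (EuclideanSpace ℝ (Fin d))) ∧
      IsOptimalMongeMap (μs i : Measure (EuclideanSpace ℝ (Fin d))) ν (F i))
    (n : ℕ) (c : ℕ → EuclideanSpace ℝ (Fin d))
    (hc : ∀ i, c i ∈ (μ : Measure (EuclideanSpace ℝ (Fin d))).support) :
    ∑ i ∈ Finset.range n, inner ℝ (c (i + 1) - c i) (f (c i))
      + inner ℝ (c 0 - c n) (f (c n)) ≤ 0 := by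
  -- The cyclic shift `i ↦ i - 1`.
  let σ : Equiv.Perm (Fin (n + 1)) := Equiv.subRight 1
  have key : ∀ η : ℝ, 0 < η →
      0 ≤ ∑ i : Fin (n + 1), (inner ℝ (c i) (f (c i) - f (c (σ i))) + η) := by
    intro η hη
    have hlim : ∀ i : Fin (n + 1), ∀ᶠ p : ι × EuclideanSpace ℝ (Fin d) × EuclideanSpace ℝ (Fin d)
        in l ×ˢ 𝓝 (c i, c (σ i)), inner ℝ p.2.1 (F p.1 p.2.1 - F p.1 p.2.2)
          < inner ℝ (c i) (f (c i) - f (c (σ i))) + η := by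
      intro i
      have t1 : Tendsto (fun p : ι × EuclideanSpace ℝ (Fin d) × EuclideanSpace ℝ (Fin d) =>
          (p.1, p.2.1)) (l ×ˢ 𝓝 (c i, c (σ i))) (l ×ˢ 𝓝 (c i)) :=
        tendsto_fst.prodMk ((continuous_fst.tendsto (c i, c (σ i))).comp tendsto_snd)
      have t2 : Tendsto (fun p : ι × EuclideanSpace ℝ (Fin d) × EuclideanSpace ℝ (Fin d) =>
          (p.1, p.2.2)) (l ×ˢ 𝓝 (c i, c (σ i))) (l ×ˢ 𝓝 (c (σ i))) :=
        tendsto_fst.prodMk ((continuous_snd.tendsto (c i, c (σ i))).comp tendsto_snd)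
      have t3 := (tendsto_snd.comp t1).mono_right (le_refl (𝓝 (c i)))
      have t4 := t3.inner (𝕜 := ℝ) (((hF (c i)).comp t1).sub ((hF (c (σ i))).comp t2))
      exact t4.eventually (gt_mem_nhds (by linarith))
    simp only [eventually_prod_iff] at hlim
    choose pa hpa pb hpb hp using hlim
    choose δ hδ hδp using fun i => Metric.eventually_nhds_iff_ball.1 (hpb i)
    -- The point `c i` occurs first in the pair of `i` and second in the pair of `σ.symm i`, hence
    -- two radii.
    let B : Fin (n + 1) → Set (EuclideanSpace ℝ (Fin d)) := fun i =>
      Metric.ball (c i) (min (δ i) (δ (σ.symm i)))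
    have hB : ∀ i : Fin (n + 1), ∀ᶠ j in l,
        0 < (μs j : Measure (EuclideanSpace ℝ (Fin d))) (B i) := fun i =>
      eventually_measure_pos_of_mem_support h (hc i) Metric.isOpen_ball
        (Metric.mem_ball_self (lt_min (hδ _) (hδ _)))
    obtain ⟨j, ⟨hj1, hj2, hj3⟩, hj4, hj5⟩ :=
      (hopt.and ((eventually_all.2 hB).and (eventually_all.2 hpa))).exists
    refine hj3.sum_nonneg hν hj2 σ (fun i => Metric.isOpen_ball.measurableSet)
      (fun i => (hj4 i).ne') _ fun i x hx y hy => ?_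
    refine (hp i (hj5 i) (y := (x, y)) (hδp i (x, y) ?_)).le
    rw [← ball_prod_same]
    refine ⟨Metric.ball_subset_ball (min_le_left _ _) hx, ?_⟩
    have := Metric.ball_subset_ball (min_le_right _ _) hy
    rwa [σ.symm_apply_apply] at this
  have hsum : 0 ≤ ∑ i : Fin (n + 1), inner ℝ (c i) (f (c i) - f (c (σ i))) := by
    refine le_of_forall_pos_le_add fun η hη => ?_
    have := key (η / (n + 1)) (by positivity)
    rw [Finset.sum_add_distrib, Finset.sum_const, Finset.card_univ, Fintype.card_fin,
      nsmul_eq_mul] at this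
    have hη' : ((n + 1 : ℕ) : ℝ) * (η / (n + 1)) = η := by
      push_cast
      field_simp
    rwa [hη'] at this
  -- Addition in `Fin (n + 1)` wraps `n` to `0`, which produces the closing term.
  have hshift : ∑ i : Fin (n + 1), inner ℝ (c i) (f (c (σ i)))
      = ∑ i : Fin (n + 1), inner ℝ (c (i + 1 : Fin (n + 1))) (f (c i)) := by
    rw [← Equiv.sum_comp (Equiv.addRight (1 : Fin (n + 1)))]
    simp [σ]
  simp_rw [inner_sub_right] at hsum
  rw [Finset.sum_sub_distrib, hshift, ← Finset.sum_sub_distrib, Fin.sum_univ_castSucc] at hsum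
  simp only [Fin.coeSucc_eq_succ, Fin.val_succ, Fin.val_castSucc, Fin.last_add_one, Fin.val_last,
    Fin.val_zero, ← inner_sub_left] at hsum
  rw [Fin.sum_univ_eq_sum_range (fun i => inner ℝ (c i - c (i + 1)) (f (c i)))] at hsum
  have hneg : ∀ i j : ℕ, ∀ w, (inner ℝ (c i - c j) w : ℝ) = - inner ℝ (c j - c i) w :=
    fun i j w => by rw [← inner_neg_left, neg_sub]
  rw [Finset.sum_congr rfl fun i _ => hneg i (i + 1) (f (c i)), hneg n 0,
    Finset.sum_neg_distrib] at hsum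
  linarith

/-- Lipschitz bounds alone allow drift to infinity. Near a point of `supp μ` the approximating
measures eventually have mass, so some nearby `y` has `F i y` bounded by `M`; the Lipschitz bound
carries this to `x`. -/
lemma eventually_norm_le_of_lipschitzOnWith {ι : Type*} {l : Filter ι}
    {μs : ι → ProbabilityMeasure (EuclideanSpace ℝ (Fin d))}
    {μ : ProbabilityMeasure (EuclideanSpace ℝ (Fin d))} (h : Tendsto μs l (𝓝 μ))
    {ν : Measure (EuclideanSpace ℝ (Fin d))} (hν : IsCompact ν.support)
    {F : ι → EuclideanSpace ℝ (Fin d) → EuclideanSpace ℝ (Fin d)} {C : ℕ → NNReal}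
    (hL : ∀ᶠ i in l, ∀ n : ℕ, LipschitzOnWith (C n) (F i) (Metric.ball 0 n))
    (hFν : ∀ᶠ i in l, Measurable (F i) ∧
      (μs i : Measure (EuclideanSpace ℝ (Fin d))).map (F i) = ν)
    (x : EuclideanSpace ℝ (Fin d)) : ∃ M : ℝ, ∀ᶠ i in l, F i x ∈ Metric.closedBall 0 M := by
  obtain ⟨M, hM0, -, hM⟩ := exists_norm_le_of_map_eq hν
  obtain ⟨x₀, hx₀⟩ := Measure.nonempty_support
    (IsProbabilityMeasure.ne_zero (μ : Measure (EuclideanSpace ℝ (Fin d))))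
  obtain ⟨n, hn⟩ := exists_nat_gt (max ‖x‖ (‖x₀‖ + 1))
  rw [max_lt_iff] at hn
  refine ⟨M + C n * (2 * n), ?_⟩
  filter_upwards [hL, hFν, eventually_measure_pos_of_mem_support h hx₀
    (Metric.isOpen_ball (x := x₀) (ε := 1)) (Metric.mem_ball_self one_pos)] with i h1 h2 h3
  have h4 := (ae_restrict_of_ae (s := Metric.ball x₀ 1) (hM _ _ h2.1 h2.2)).and
    (ae_restrict_mem (Metric.isOpen_ball (x := x₀) (ε := 1)).measurableSet)
  have : ((μs i : Measure (EuclideanSpace ℝ (Fin d))).restrict (Metric.ball x₀ 1)) ≠ 0 := by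
    rw [Ne, Measure.restrict_eq_zero]
    exact h3.ne'
  have : NeBot (ae ((μs i : Measure (EuclideanSpace ℝ (Fin d))).restrict (Metric.ball x₀ 1))) :=
    ae_neBot.2 this
  obtain ⟨y, hy1, hy2⟩ := h4.exists
  have hyn : ‖y‖ < n := by
    rw [mem_ball_iff_norm] at hy2
    have := norm_add_le (y - x₀) x₀
    rw [sub_add_cancel] at this
    linarith
  have h5 := (h1 n).dist_le_mul x (by simpa using hn.1) y (by simpa using hyn)
  have h6 : dist x y ≤ 2 * n := by
    rw [dist_eq_norm]
    linarith [norm_sub_le x y]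
  rw [mem_closedBall_zero_iff]
  have h7 := norm_add_le (F i x - F i y) (F i y)
  rw [sub_add_cancel, ← dist_eq_norm] at h7
  have h8 : (C n : ℝ) * dist x y ≤ C n * (2 * n) := by gcongr
  linarith

end

/-! ### Existence of an optimal limit and conclusion -/

/-- Dimension zero is separate: Lebesgue measure is then a point mass, so absolute continuity does
not exclude atoms. -/
lemma exists_isOptimalMongeMap_of_subsingleton {d : ℕ} [Subsingleton (EuclideanSpace ℝ (Fin d))]
    (μ ν : ProbabilityMeasure (EuclideanSpace ℝ (Fin d))) :
    ∃ S : EuclideanSpace ℝ (Fin d) → EuclideanSpace ℝ (Fin d),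
      IsOptimalMongeMap (μ : Measure (EuclideanSpace ℝ (Fin d))) ν S := by
  refine ⟨id, measurable_id, ?_, fun S _ _ => ?_⟩
  · rw [Measure.map_id]
    ext s _
    rcases s.eq_empty_or_nonempty with rfl | hs
    · simp
    · rw [Subsingleton.eq_univ_of_nonempty hs]
      simp
  · simp [quadraticMongeCost]

lemma IsOptimalMongeMap.congr {d : ℕ} {μ ν : Measure (EuclideanSpace ℝ (Fin d))}
    {T f : EuclideanSpace ℝ (Fin d) → EuclideanSpace ℝ (Fin d)} (hT : IsOptimalMongeMap μ ν T)
    (hf : Measurable f) (h : f =ᵐ[μ] T) : IsOptimalMongeMap μ ν f := by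
  refine ⟨hf, (Measure.map_congr h).trans hT.2.1, fun S hS hSν => ?_⟩
  refine le_trans (le_of_eq (lintegral_congr_ae ?_)) (hT.2.2 S hS hSν)
  filter_upwards [h] with x hx
  rw [hx]

lemma continuous_of_forall_lipschitzOnWith_ball {X Y : Type*} [PseudoMetricSpace X]
    [PseudoMetricSpace Y] {f : X → Y} (x₀ : X) {C : ℕ → NNReal}
    (hf : ∀ n : ℕ, LipschitzOnWith (C n) f (Metric.ball x₀ n)) : Continuous f := by
  refine continuous_iff_continuousAt.2 fun x => ?_
  obtain ⟨n, hn⟩ := exists_nat_gt (dist x x₀)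
  exact (hf n).continuousOn.continuousAt (Metric.isOpen_ball.mem_nhds hn)

/-- Limits of locally uniformly Lipschitz optimal maps: if such maps exist along weakly convergent
absolutely continuous measures, then the limit measure has an optimal map. -/
lemma exists_isOptimalMongeMap_of_tendsto {d : ℕ} {ι : Type*} {l : Filter ι} [l.NeBot]
    {μs : ι → ProbabilityMeasure (EuclideanSpace ℝ (Fin d))}
    {μ ν : ProbabilityMeasure (EuclideanSpace ℝ (Fin d))} (h : Tendsto μs l (𝓝 μ))
    (hν : IsCompact (ν : Measure (EuclideanSpace ℝ (Fin d))).support)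
    {F : ι → EuclideanSpace ℝ (Fin d) → EuclideanSpace ℝ (Fin d)} {C : ℕ → NNReal}
    (hL : ∀ᶠ i in l, ∀ n : ℕ, LipschitzOnWith (C n) (F i) (Metric.ball 0 n))
    (hopt : ∀ᶠ i in l, NullSingletonClass (μs i : Measure (EuclideanSpace ℝ (Fin d))) ∧
      Integrable (fun x => ‖x‖ ^ 2) (μs i : Measure (EuclideanSpace ℝ (Fin d))) ∧
      IsOptimalMongeMap (μs i : Measure (EuclideanSpace ℝ (Fin d))) ν (F i)) :
    ∃ f, IsOptimalMongeMap (μ : Measure (EuclideanSpace ℝ (Fin d))) ν f := by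
  -- An ultrafilter makes every bounded orbit converge, in place of a diagonal subsequence.
  let U : Ultrafilter ι := Ultrafilter.of l
  have hU : (U : Filter ι) ≤ l := Ultrafilter.of_le l
  replace h := h.mono_left hU
  replace hL := hL.filter_mono hU
  replace hopt := hopt.filter_mono hU
  have hmap : ∀ᶠ i in (U : Filter ι), Measurable (F i) ∧
      (μs i : Measure (EuclideanSpace ℝ (Fin d))).map (F i) = ν :=
    hopt.mono fun i hi => ⟨hi.2.2.1, hi.2.2.2.1⟩
  have hlim : ∀ x, ∃ y, Tendsto (fun i => F i x) U (𝓝 y) := by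
    intro x
    obtain ⟨M, hM⟩ := eventually_norm_le_of_lipschitzOnWith h hν hL hmap x
    obtain ⟨y, -, hy⟩ := (isCompact_closedBall (0 : EuclideanSpace ℝ (Fin d)) M).ultrafilter_le_nhds
      (U.map fun i => F i x) (le_principal_iff.2 hM)
    exact ⟨y, hy⟩
  choose f hf using hlim
  have hfc : Continuous f := continuous_of_forall_lipschitzOnWith_ball 0 fun n =>
    lipschitzOnWith_of_tendsto (hL.mono fun i hi => hi n) fun x _ => hf x
  have hF : ∀ x, Tendsto (fun p : ι × EuclideanSpace ℝ (Fin d) => F p.1 p.2)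
      ((U : Filter ι) ×ˢ 𝓝 x) (𝓝 (f x)) := by
    intro x
    obtain ⟨n, hn⟩ := exists_nat_gt (dist x 0)
    exact tendsto_prod_nhds_of_lipschitzOnWith (hL.mono fun i hi => hi n)
      (Metric.isOpen_ball.mem_nhds hn) (hf x)
  exact ⟨f, isOptimalMongeMap_of_cyclicallyMonotone hν hfc (map_eq_of_tendsto h hfc hF hmap)
    (cyclicallyMonotone_of_tendsto h hν hF hopt)⟩

theorem mainTheorem7 (d : ℕ)
    (μ ν : ProbabilityMeasure (EuclideanSpace ℝ (Fin d)))
    (hν : IsCompact (ν : Measure (EuclideanSpace ℝ (Fin d))).support)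
    (hno : ¬ ∃ S : EuclideanSpace ℝ (Fin d) → EuclideanSpace ℝ (Fin d),
      IsOptimalMongeMap (μ : Measure (EuclideanSpace ℝ (Fin d))) ν S)
    (με : ℝ → ProbabilityMeasure (EuclideanSpace ℝ (Fin d)))
    (hac : ∀ ε : ℝ, 0 < ε → (με ε : Measure (EuclideanSpace ℝ (Fin d))) ≪ volume)
    (hmom : ∀ ε : ℝ, 0 < ε →
      (∫⁻ x, ‖x‖ₑ ^ 2 ∂(με ε : Measure (EuclideanSpace ℝ (Fin d)))) < ⊤)
    (hweak : Tendsto με (𝓝[>] 0) (𝓝 μ))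
    (T : ℝ → EuclideanSpace ℝ (Fin d) → EuclideanSpace ℝ (Fin d))
    (hT : ∀ ε : ℝ, 0 < ε →
      IsOptimalMongeMap (με ε : Measure (EuclideanSpace ℝ (Fin d))) ν (T ε)) :
    ∃ R₀ : ℝ, 0 < R₀ ∧
      (⨆ ε ∈ Set.Ioc (0 : ℝ) 1, gradLinftyNorm (Metric.ball 0 R₀) (T ε)) = ⊤ := by
  by_contra! hcon
  rcases Nat.eq_zero_or_pos d with rfl | hd
  · exact hno (exists_isOptimalMongeMap_of_subsingleton μ ν)
  have : Nonempty (Fin d) := ⟨⟨0, hd⟩⟩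
  -- Radius `n + 1`, because mollification yields the Lipschitz bound only on a smaller ball, here
  -- of radius `n`.
  have hC : ∀ n : ℕ, ∃ C : NNReal, ∀ ε ∈ Set.Ioc (0 : ℝ) 1,
      gradLinftyNorm (Metric.ball 0 ((n : ℝ) + 1)) (T ε) < C := by
    intro n
    obtain ⟨C, hC⟩ := ENNReal.lt_iff_exists_nnreal_btwn.1
      (lt_top_iff_ne_top.2 (hcon ((n : ℝ) + 1) (by positivity)))
    exact ⟨C, fun ε hε => (le_iSup₂ (f := fun ε _ => gradLinftyNorm (Metric.ball 0 ((n : ℝ) + 1))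
      (T ε)) ε hε).trans_lt hC.1⟩
  choose C hC using hC
  choose! F hFT hFL using fun ε (hε : ε ∈ Set.Ioc (0 : ℝ) 1) =>
    exists_lipschitzOnWith_ae_eq fun n => hC n ε hε
  have hev : ∀ᶠ ε in 𝓝[>] (0 : ℝ), ε ∈ Set.Ioc (0 : ℝ) 1 := Ioc_mem_nhdsGT one_pos
  refine hno (exists_isOptimalMongeMap_of_tendsto hweak hν (F := F) (hev.mono hFL)
    (hev.mono fun ε hε => ⟨⟨fun x => hac ε hε.1 (measure_singleton x)⟩,
      integrable_norm_sq_of_lintegral_enorm_sq_lt_top (hmom ε hε.1), ?_⟩))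
  exact (hT ε hε.1).congr (continuous_of_forall_lipschitzOnWith_ball 0 (hFL ε hε)).measurable
    ((hac ε hε.1).ae_eq (hFT ε hε))
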